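/- A *pseudoword* of arity $n$ is an $n$-ary implicit operation on finite semigroups, i.e. a family of maps $w_S : S^n \to S$ ($S$ a finite semigroup) commuting with all homomorphisms between finite semigroups. Examples are the multiplication $(x,y)\mapsto xy$ and the unary operation $x\mapsto x^{\omega-1}$ which sends an element $s$ of a finite semigroup with $k$ elements to the inverse of $s^{1+k!}$ in the cyclic group generated by this power; these two form the canonical signature $\kappa$. For $\kappa$-terms $w_1,\dots,w_n$ in the letters $a_1,\dots,a_n$, let $M(w_1,\dots,w_n)$ be the $n\times n$ integer matrix whose $(i,j)$-entry is the sum of the exponents of $a_j$ in $w_i$, read as a group word. On every finite semigroup $S$ the terms $w_1,\dots,w_n$ induce a map $S^n\to S^n$; let $a_j\circ(w_1,\dots,w_n)^\omega$ be the $j$-th component of the unique idempotent among the positive iterates of this map, and let $x^{m^\omega}=\lim_{k\to\infty}x^{m^{k!}}$. Let $\sigma$ be the implicit signature obtained by adding to $\kappa$ all implicit operations of the form $$\bigl(a_j\circ(w_1,\dots,w_n)^{\omega}\bigr)^{m^\omega},$$ where $n\ge 1$, $1\le j\le n$, $w_1,\dots,w_n$ are $\kappa$-terms in $a_1,\dots,a_n$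 with $\det M(w_1,\dots,w_n)\neq 0$, and $m$ is a positive integer divisible by every prime divisor of $\det M(w_1,\dots,w_n)$. Let $\mathsf{G}_{nil}$ be the pseudovariety of all finite nilpotent groups, let $A$ be a finite alphabet, let $\overline{\Omega}_A\mathsf{G}_{nil}$ be the free pro-$\mathsf{G}_{nil}$ semigroup on $A$ (equivalently, the semigroup of $A$-ary implicit operations on finite nilpotent groups), regarded as a $\sigma$-algebra, and let $\Omega^\sigma_A\mathsf{G}_{nil}$ be its $\sigma$-subalgebra generated by $A$. **Corollary.** The word problem is decidable in $\Omega^\sigma_A\mathsf{G}_{nil}$: there is an algorithm which, given any two $\sigma$-terms over $A$, decides whether they represent the same element of $\Omega^\sigma_A\mathsf{G}_{nil}$. -/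

import Mathlib

namespace SigmaWord

open Function

/-! ### Powers in finite semigroups -/

/-- The power `x ^ k` of an element of a semigroup, for `k ≥ 1` (for `k = 0` the value is `x`,
and is never used). -/
def sgPow {S : Type*} [Semigroup S] (x : S) (k : ℕ) : S := (fun y => x * y)^[k - 1] x

/-- In a finite set with `N` elements, the iterates of exponent at least `N - 1` of a self-map are
periodic, of period dividing `N !`. -/
theorem iterate_stable {X : Type*} [Finite X] (g : X → X) (x : X) {i d : ℕ}
    (hi : Nat.card X ≤ i + 1) (hd : (Nat.card X).factorial ∣ d) :
    g^[i + d] x = g^[i] x := by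
  classical
  have := Fintype.ofFinite X
  obtain ⟨a, b, hab, he⟩ := Fintype.exists_ne_map_eq_of_card_lt
    (fun k : Fin (Nat.card X + 1) => g^[k] x) (by simp)
  wlog h : (a : ℕ) < b generalizing a b
  · exact this b a hab.symm he.symm
      (lt_of_le_of_ne (not_lt.mp h) (fun hh => hab (Fin.ext hh.symm)))
  have hb : (b : ℕ) ≤ Nat.card X := Nat.lt_succ_iff.mp b.2
  have hper : IsPeriodicPt g (b - a) (g^[a] x) := by
    change g^[b - a] (g^[a] x) = g^[a] x
    rw [← iterate_add_apply, Nat.sub_add_cancel h.le]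
    exact he.symm
  have h1 := hper.apply_iterate (i - a)
  rw [← iterate_add_apply, Nat.sub_add_cancel (by omega)] at h1
  have h2 : (b - a : ℕ) ∣ d := (Nat.dvd_factorial (by omega) (by omega)).trans hd
  have h3 : g^[d] (g^[i] x) = g^[i] x := h1.trans_dvd h2
  rw [add_comm, iterate_add_apply, h3]

/-- For every `k ≥ |X|`, the `k !`-th iterate of `g` equals the `|X| !`-th one. -/
theorem iterate_factorial {X : Type*} [Finite X] (g : X → X) {k : ℕ} (hk : Nat.card X ≤ k) :
    g^[k.factorial] = g^[(Nat.card X).factorial] := by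
  funext x
  have hle := Nat.factorial_le hk
  have hN := Nat.self_le_factorial (Nat.card X)
  have := iterate_stable g x (i := (Nat.card X).factorial)
    (d := k.factorial - (Nat.card X).factorial) (by omega)
    (Nat.dvd_sub (Nat.factorial_dvd_factorial hk) dvd_rfl)
  rwa [Nat.add_sub_cancel' hle] at this

/-- The `ω`-power of a transformation of a finite set: its unique idempotent positive iterate
(see `omegaIter_idem`). -/
noncomputable def omegaIter {X : Type*} (g : X → X) : X → X := g^[(Nat.card X).factorial]

theorem omegaIter_idem {X : Type*} [Finite X] (g : X → X) :
    omegaIter g ∘ omegaIter g = omegaIter g ∧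
      ∀ k, 1 ≤ k → g^[k] ∘ g^[k] = g^[k] → g^[k] = omegaIter g := by
  have hN := Nat.self_le_factorial (Nat.card X)
  refine ⟨?_, fun k hk hid => ?_⟩
  · funext x
    have := iterate_stable g x (i := (Nat.card X).factorial) (by omega) dvd_rfl
    rw [iterate_add_apply] at this
    exact this
  · have hall : ∀ c, (g^[k])^[c + 1] = g^[k] := by
      intro c
      induction c with
      | zero => rfl
      | succ c ih => rw [iterate_succ, ih, hid]
    have hf := Nat.factorial_pos (Nat.card X)
    have h1 := hall ((Nat.card X).factorial - 1)
    rw [Nat.sub_add_cancel hf, ← iterate_mul] at h1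
    rw [← h1]
    funext x
    have h2 := iterate_stable g x (i := (Nat.card X).factorial)
      (d := (k - 1) * (Nat.card X).factorial) (by omega) (dvd_mul_left _ _)
    have h3 : (Nat.card X).factorial + (k - 1) * (Nat.card X).factorial
        = k * (Nat.card X).factorial := by
      obtain ⟨k, rfl⟩ : ∃ j, k = j + 1 := ⟨k - 1, by omega⟩
      simp only [Nat.add_sub_cancel]; ring
    rw [h3] at h2
    exact h2

section Semigroup

variable {S : Type*} [Semigroup S]

theorem sgPow_succ (x : S) {k : ℕ} (hk : 1 ≤ k) : sgPow x (k + 1) = x * sgPow x k := by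
  obtain ⟨k, rfl⟩ : ∃ j, k = j + 1 := ⟨k - 1, by omega⟩
  simp only [sgPow, Nat.add_sub_cancel, iterate_succ_apply']

theorem sgPow_add (x : S) {k l : ℕ} (hk : 1 ≤ k) (hl : 1 ≤ l) :
    sgPow x (k + l) = sgPow x k * sgPow x l := by
  induction k, hk using Nat.le_induction with
  | base => rw [add_comm, sgPow_succ x hl]; rfl
  | succ k hk ih =>
    rw [add_right_comm, sgPow_succ x (by omega), ih, sgPow_succ x hk, mul_assoc]

theorem sgPow_mul (x : S) {k l : ℕ} (hk : 1 ≤ k) (hl : 1 ≤ l) :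
    sgPow x (k * l) = sgPow (sgPow x k) l := by
  induction l, hl using Nat.le_induction with
  | base => simp only [mul_one]; rfl
  | succ l hl ih =>
    rw [mul_add, mul_one, add_comm, sgPow_add x hk (Nat.mul_pos hk hl), ih, sgPow_succ _ hl]

theorem map_sgPow {T : Type*} [Semigroup T] (f : S →ₙ* T) (x : S) (k : ℕ) :
    f (sgPow x k) = sgPow (f x) k := by
  have h : Semiconj f (fun y => x * y) (fun y => f x * y) := fun y => map_mul f x y
  exact (h.iterate_right (k - 1)) x

theorem sgPow_stable [Finite S] (x : S) {i d : ℕ} (hi : Nat.card S ≤ i) (hi1 : 1 ≤ i)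
    (hd : (Nat.card S).factorial ∣ d) : sgPow x (i + d) = sgPow x i := by
  have := iterate_stable (fun y => x * y) x (i := i - 1) (d := d) (by omega) hd
  rw [sgPow, sgPow, ← this]
  congr 2
  omega

/-- `x ^ (ω - 1)` in the finite semigroup `S`: with `e = x ^ (n !)` the idempotent power of `x`,
where `n = |S|`, this is the inverse of `x ^ (1 + n !)` in the cyclic group with identity `e` that
`x ^ (1 + n !)` generates (see `omegaInv_spec`). -/
noncomputable def omegaInv (x : S) : S := sgPow x (2 * (Nat.card S).factorial - 1)

theorem omegaInv_spec [Finite S] (x : S) :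
    let e := sgPow x (Nat.card S).factorial
    let y := sgPow x (1 + (Nat.card S).factorial)
    e * e = e ∧ e * omegaInv x = omegaInv x ∧ omegaInv x * e = omegaInv x ∧
      y * omegaInv x = e ∧ omegaInv x * y = e := by
  have hN := Nat.self_le_factorial (Nat.card S)
  have hf := Nat.factorial_pos (Nat.card S)
  have hi := sgPow_stable x (d := (Nat.card S).factorial) hN hf dvd_rfl
  have hj := sgPow_stable x (i := 2 * (Nat.card S).factorial - 1)
    (d := (Nat.card S).factorial) (by omega) (by omega) dvd_rfl
  have hk := sgPow_stable x (d := 2 * (Nat.card S).factorial) hN hf (dvd_mul_left _ _)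
  refine ⟨?_, ?_, ?_, ?_, ?_⟩
  · rw [← sgPow_add x hf hf, hi]
  · rw [omegaInv, ← sgPow_add x hf (by omega), add_comm, hj]
  · rw [omegaInv, ← sgPow_add x (by omega) hf, hj]
  · rw [omegaInv, ← sgPow_add x (by omega) (by omega), ← hk]
    congr 1
    omega
  · rw [omegaInv, ← sgPow_add x (by omega) (by omega), ← hk]
    congr 1
    omega

/-- `x ^ (m ^ ω) = lim_k x ^ (m ^ (k !))` in the finite semigroup `S`, for `m ≥ 1`: the sequence is
constant from `k = |S|` on (see `sgPow_pow_factorial`). -/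
noncomputable def powOmega (m : ℕ) (x : S) : S := sgPow x (m ^ (Nat.card S).factorial)

theorem sgPow_pow_eq_iterate {m : ℕ} (hm : 1 ≤ m) (x : S) (k : ℕ) :
    sgPow x (m ^ k) = (fun y => sgPow y m)^[k] x := by
  induction k with
  | zero => rfl
  | succ k ih =>
    rw [pow_succ, sgPow_mul x (Nat.pow_pos hm) hm, ih, iterate_succ_apply']

theorem sgPow_pow_factorial [Finite S] {m : ℕ} (hm : 1 ≤ m) (x : S) {k : ℕ}
    (hk : Nat.card S ≤ k) : sgPow x (m ^ k.factorial) = powOmega m x := by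
  rw [powOmega, sgPow_pow_eq_iterate hm, sgPow_pow_eq_iterate hm, iterate_factorial _ hk]

theorem map_powOmega {T : Type*} [Semigroup T] [Finite S] [Finite T] {m : ℕ} (hm : 1 ≤ m)
    (f : S →ₙ* T) (x : S) : f (powOmega m x) = powOmega m (f x) := by
  rw [← sgPow_pow_factorial hm x (le_max_left _ (Nat.card T)), map_sgPow,
    sgPow_pow_factorial hm (f x) (le_max_right _ _)]

theorem sgPow_two_factorial [Finite S] (x : S) {k : ℕ} (hk : Nat.card S ≤ k) :
    sgPow x (2 * k.factorial - 1) = omegaInv x := by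
  have hle := Nat.factorial_le hk
  have hN := Nat.self_le_factorial (Nat.card S)
  have hf := Nat.factorial_pos (Nat.card S)
  have := sgPow_stable x (i := 2 * (Nat.card S).factorial - 1)
    (d := 2 * (k.factorial - (Nat.card S).factorial)) (by omega) (by omega)
    ((Nat.dvd_sub (Nat.factorial_dvd_factorial hk) dvd_rfl).mul_left 2)
  rw [omegaInv, ← this]
  congr 1
  omega

theorem map_omegaInv {T : Type*} [Semigroup T] [Finite S] [Finite T] (f : S →ₙ* T) (x : S) :
    f (omegaInv x) = omegaInv (f x) := by
  rw [← sgPow_two_factorial x (le_max_left _ (Nat.card T)), map_sgPow,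
    sgPow_two_factorial (f x) (le_max_right _ _)]

end Semigroup

theorem omegaIter_semiconj {X Y : Type*} [Finite X] [Finite Y] {h : X → Y} {g : X → X} {g' : Y → Y}
    (hs : Semiconj h g g') : Semiconj h (omegaIter g) (omegaIter g') := by
  unfold omegaIter
  rw [← iterate_factorial g (le_max_left _ (Nat.card Y)),
    ← iterate_factorial g' (le_max_right (Nat.card X) _)]
  exact hs.iterate_right _

/-! ### Implicit operations -/

/-- A finite semigroup. -/
structure FinSemigroup where
  carrier : Type
  [semigroup : Semigroup carrier]
  [finite : Finite carrier]

instance : CoeSort FinSemigroup Type := ⟨FinSemigroup.carrier⟩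

instance (S : FinSemigroup) : Semigroup S := S.semigroup

instance (S : FinSemigroup) : Finite S := S.finite

/-- The pseudovariety of all finite semigroups. -/
def allSemigroups : Set FinSemigroup := Set.univ

/-- The pseudovariety of all finite nilpotent groups. -/
def Gnil : Set FinSemigroup :=
  {S | ∃ (G : Type) (_ : Group G), Group.IsNilpotent G ∧ Nonempty (S ≃* G)}

/-- The set of `A`-ary implicit operations on the class `V`: the families of functions
`w_S : (A → S) → S`, for `S` in `V`, that commute with all homomorphisms between members of `V`.
For a finite set `A` and a pseudovariety `V` this is the free pro-`V` semigroup on `A`. -/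
@[ext]
structure ImplicitOp (V : Set FinSemigroup) (A : Type*) where
  op : ∀ S : FinSemigroup, S ∈ V → (A → S) → S
  natural : ∀ (S T : FinSemigroup) (hS : S ∈ V) (hT : T ∈ V) (f : S →ₙ* T) (φ : A → S),
    f (op S hS φ) = op T hT (f ∘ φ)

/-- An `n`-ary implicit operation on finite semigroups. -/
abbrev Pseudoword (n : ℕ) := ImplicitOp allSemigroups (Fin n)

namespace ImplicitOp

variable {V : Set FinSemigroup} {A : Type*}

/-- The letter `a`, that is, the component projection. -/
def letter (a : A) : ImplicitOp V A where
  op _ _ φ := φ a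
  natural _ _ _ _ _ _ := rfl

/-- The multiplication, a binary implicit operation. -/
def mulOp : Pseudoword 2 where
  op _ _ φ := φ 0 * φ 1
  natural _ _ _ _ f _ := map_mul f _ _

/-- The unary implicit operation `x ↦ x ^ (ω - 1)`. -/
noncomputable def omegaInvOp : Pseudoword 1 where
  op _ _ φ := omegaInv (φ 0)
  natural _ _ _ _ f _ := map_omegaInv f _

/-- The natural interpretation of an `n`-ary implicit operation `w` on finite semigroups as an
`n`-ary operation on the free pro-`V` semigroup. -/
def interp {n : ℕ} (w : Pseudoword n) (u : Fin n → ImplicitOp V A) : ImplicitOp V A where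
  op S hS φ := w.op S trivial (fun i => (u i).op S hS φ)
  natural S T hS hT f φ := by
    rw [w.natural S T trivial trivial f]
    congr 1
    funext i
    exact (u i).natural S T hS hT f φ

/-- The implicit operator `(w_1, ..., w_n)` on `S`. -/
def operator {n : ℕ} (w : Fin n → Pseudoword n) (S : FinSemigroup) : (Fin n → S) → (Fin n → S) :=
  fun s i => (w i).op S trivial s

/-- The implicit operation `(a_j ∘ (w_1, ..., w_n) ^ ω) ^ (m ^ ω)`, where `m ≥ 1`: the `m ^ ω`-th
power of the `j`-th component of the `ω`-power of the operator `(w_1, ..., w_n)`. -/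
noncomputable def opOmega {n : ℕ} (w : Fin n → Pseudoword n) (j : Fin n) (m : ℕ) (hm : 1 ≤ m) :
    Pseudoword n where
  op S _ s := powOmega m (omegaIter (operator w S) s j)
  natural S T _ _ f s := by
    rw [map_powOmega hm]
    congr 1
    have h : Semiconj (fun s : Fin n → S => (f ∘ s : Fin n → T)) (operator w S) (operator w T) := by
      intro s
      funext i
      exact (w i).natural S T trivial trivial f s
    exact congrFun (omegaIter_semiconj h s) j

end ImplicitOp

open ImplicitOp

/-! ### `κ`-terms and the signature `σ` -/

/-- Terms over the canonical signature `κ` (multiplication and `x ↦ x ^ (ω - 1)`) in the letters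
`a_1, ..., a_n`. -/
inductive KappaTerm (n : ℕ) : Type
  | letter (i : Fin n) : KappaTerm n
  | mul (s t : KappaTerm n) : KappaTerm n
  | inv (s : KappaTerm n) : KappaTerm n

namespace KappaTerm

variable {n : ℕ}

/-- The pseudoword represented by a `κ`-term. -/
noncomputable def value : KappaTerm n → Pseudoword n
  | letter i => ImplicitOp.letter i
  | mul s t => interp mulOp ![s.value, t.value]
  | inv s => interp omegaInvOp ![s.value]

/-- The sum of the exponents of the letter `a_j` in a `κ`-term, read as a group word. -/
def expSum (j : Fin n) : KappaTerm n → ℤ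
  | letter i => if i = j then 1 else 0
  | mul s t => s.expSum j + t.expSum j
  | inv s => - s.expSum j

/-- Gödel number of a `κ`-term. -/
def code : KappaTerm n → ℕ
  | letter i => Nat.pair 0 i
  | mul s t => Nat.pair 1 (Nat.pair s.code t.code)
  | inv s => Nat.pair 2 s.code

end KappaTerm

/-- The matrix `M(w_1, ..., w_n)` of exponent sums. -/
def expMatrix {n : ℕ} (w : Fin n → KappaTerm n) : Matrix (Fin n) (Fin n) ℤ :=
  Matrix.of fun i j => (w i).expSum j

/-- The operation symbols of the signature `σ`: multiplication, `x ↦ x ^ (ω - 1)`, and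
`(a_j ∘ (w_1, ..., w_n) ^ ω) ^ (m ^ ω)` for all `κ`-terms `w_1, ..., w_n` in `n` letters with
`det M(w_1, ..., w_n) ≠ 0` and all positive integers `m` that are divisible by every prime divisor
of this determinant. -/
inductive SigmaSymbol : Type
  | mul : SigmaSymbol
  | inv : SigmaSymbol
  | opOmega (n : ℕ) (w : Fin n → KappaTerm n) (j : Fin n) (m : ℕ) (hm : 1 ≤ m)
      (hdet : (expMatrix w).det ≠ 0)
      (hdiv : ∀ p : ℕ, p.Prime → (p : ℤ) ∣ (expMatrix w).det → p ∣ m) : SigmaSymbol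

namespace SigmaSymbol

/-- The arity of an operation symbol. -/
def arity : SigmaSymbol → ℕ
  | mul => 2
  | inv => 1
  | opOmega n _ _ _ _ _ _ => n

/-- The implicit operation denoted by an operation symbol. -/
noncomputable def value : (f : SigmaSymbol) → Pseudoword f.arity
  | mul => mulOp
  | inv => omegaInvOp
  | opOmega _ w j m hm _ _ => ImplicitOp.opOmega (fun i => (w i).value) j m hm

/-- Gödel number of an operation symbol. -/
def code : SigmaSymbol → ℕ
  | mul => 0
  | inv => 1
  | opOmega _ w j m _ _ _ =>
      2 + Nat.pair j (Nat.pair m (Encodable.encode (List.ofFn fun i => (w i).code)))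

end SigmaSymbol

/-- An implicit signature: a set of implicit operations on finite semigroups, of finite arities,
that contains the multiplication. -/
structure ImplicitSignature where
  ops : Set (Σ n, Pseudoword n)
  mul_mem : ⟨2, mulOp⟩ ∈ ops

/-- The implicit signature `σ`. -/
noncomputable def sigma : ImplicitSignature where
  ops := Set.range fun f : SigmaSymbol => ⟨f.arity, f.value⟩
  mul_mem := ⟨SigmaSymbol.mul, rfl⟩

/-- `Omega τ V A` is the `τ`-subalgebra generated by `A` of the free pro-`V` semigroup on `A`: the
smallest set that contains the letters and is closed under the operations in `τ`. -/
inductive Omega (τ : ImplicitSignature) (V : Set FinSemigroup) (A : Type*) :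
    Set (ImplicitOp V A)
  | letter (a : A) : Omega τ V A (ImplicitOp.letter a)
  | app {n : ℕ} (w : Pseudoword n) (hw : ⟨n, w⟩ ∈ τ.ops) (u : Fin n → ImplicitOp V A)
      (hu : ∀ i, Omega τ V A (u i)) : Omega τ V A (interp w u)

/-- The `σ`-terms over the alphabet `A`. -/
inductive SigmaTerm (A : Type*)
  | letter (a : A) : SigmaTerm A
  | app (f : SigmaSymbol) (args : Fin f.arity → SigmaTerm A) : SigmaTerm A

namespace SigmaTerm

variable {A : Type*}

/-- The element of the free pro-`V` semigroup on `A` represented by a `σ`-term. -/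
noncomputable def eval (V : Set FinSemigroup) : SigmaTerm A → ImplicitOp V A
  | letter a => ImplicitOp.letter a
  | app f args => interp f.value fun i => (args i).eval V

theorem eval_mem (V : Set FinSemigroup) : ∀ t : SigmaTerm A, t.eval V ∈ Omega sigma V A
  | letter a => Omega.letter a
  | app f args => Omega.app f.value (show _ ∈ Set.range _ from ⟨f, rfl⟩) _ fun i => eval_mem V (args i)

/-- The element of the `σ`-algebra `Ω^σ_A V` represented by a `σ`-term. -/
noncomputable def value (V : Set FinSemigroup) (t : SigmaTerm A) : Omega sigma V A :=
  ⟨t.eval V, t.eval_mem V⟩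

/-- Every element of `Ω^σ_A V` is represented by a `σ`-term. -/
theorem value_surjective (V : Set FinSemigroup) :
    Function.Surjective (value V : SigmaTerm A → Omega sigma V A) := by
  rintro ⟨w, hw⟩
  suffices h : ∃ t : SigmaTerm A, t.eval V = w by
    obtain ⟨t, ht⟩ := h
    exact ⟨t, Subtype.ext ht⟩
  induction hw with
  | letter a => exact ⟨letter a, rfl⟩
  | app w hw u _ ih =>
    obtain ⟨f, hf⟩ := hw
    cases hf
    choose t ht using ih
    refine ⟨app f t, ?_⟩
    simp only [eval, ht]

/-- Gödel number of a `σ`-term. -/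
def code [Encodable A] : SigmaTerm A → ℕ
  | letter a => Nat.pair 0 (Encodable.encode a)
  | app f args =>
      Nat.pair 1 (Nat.pair f.code (Encodable.encode (List.ofFn fun i => (args i).code)))

end SigmaTerm

/-! ### Different terms have different Gödel numbers -/

theorem KappaTerm.code_injective {n : ℕ} : Function.Injective (KappaTerm.code (n := n)) := by
  intro s
  induction s with
  | letter i => rintro (j | ⟨s, t⟩ | s) h <;> simp [code, Nat.pair_eq_pair, Fin.ext_iff] at h ⊢
                exact h
  | mul s t ihs iht =>
    rintro (j | ⟨s', t'⟩ | s') h <;> simp [code, Nat.pair_eq_pair] at h ⊢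
    exact ⟨ihs h.1, iht h.2⟩
  | inv s ih =>
    rintro (j | ⟨s', t'⟩ | s') h <;> simp [code, Nat.pair_eq_pair] at h ⊢
    exact ih h

theorem SigmaSymbol.code_injective : Function.Injective SigmaSymbol.code := by
  rintro (_ | _ | ⟨n, w, j, m, _, _, _⟩) (_ | _ | ⟨n', w', j', m', _, _, _⟩) h <;>
    simp only [code] at h <;> try first | rfl | omega
  have h' := Nat.add_left_cancel h
  simp only [Nat.pair_eq_pair, Encodable.encode_inj] at h'
  obtain ⟨hj, rfl, hl⟩ := h'
  obtain rfl : n = n' := by simpa using congrArg List.length hl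
  obtain rfl : w = w' := by
    funext i
    exact KappaTerm.code_injective (congrFun (List.ofFn_injective hl) i)
  obtain rfl : j = j' := Fin.ext hj
  rfl

theorem SigmaTerm.code_injective {A : Type*} [Encodable A] :
    Function.Injective (SigmaTerm.code (A := A)) := by
  intro s
  induction s with
  | letter a =>
    rintro (b | ⟨g, v⟩) h
    · simpa [code, Nat.pair_eq_pair] using h
    · simp [code, Nat.pair_eq_pair] at h
  | app f u ih =>
    rintro (b | ⟨g, v⟩) h
    · simp [code, Nat.pair_eq_pair] at h
    · simp only [code, Nat.pair_eq_pair, Encodable.encode_inj, true_and] at h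
      obtain ⟨hfg, hl⟩ := h
      obtain rfl := SigmaSymbol.code_injective hfg
      obtain rfl : u = v := by
        funext i
        exact ih i (congrFun (List.ofFn_injective hl) i)
      rfl

/-- The word problem for `Ω^σ_A V` is decidable: there is an algorithm (a total computable function)
that, given (the Gödel numbers of) two `σ`-terms over `A`, decides whether they represent the same
element of `Ω^σ_A V`. -/
def DecidableWordProblem (V : Set FinSemigroup) (A : Type*) [Encodable A] : Prop :=
  ∃ D : ℕ × ℕ → Bool, Computable D ∧
    ∀ s t : SigmaTerm A, D (s.code, t.code) = true ↔ s.value V = t.value V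

end SigmaWord

namespace SigmaWord

open Function ImplicitOp

/-! ### The operations of `σ` on finite groups -/

/-! The point is that on finite `p`-groups every operation of `σ` collapses to a group word. On
groups `x ↦ x ^ (ω - 1)` is inversion. For `(a_j ∘ (w_1, ..., w_n) ^ ω) ^ (m ^ ω)` there are two
cases. If `p ∣ m`, the `m ^ ω`-th power is trivial. If `p ∤ m`, then `p` does not divide the
determinant either; the operator is then injective on tuples (`groupEval_injective`), so its
`ω`-power is the identity, the `m ^ ω`-th power is the identity as well, and the operation is the
projection to `a_j` (`opOmega_op`).

So for each prime `p` a term `t` reduces to an element `t.toFreeGroup p` of the free group that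
gives its value on all finite `p`-groups. Free groups are residually finite `p`-groups
(`exists_isPGroup_hom_ne_one`) and finite nilpotent groups are products of their Sylow subgroups, so
two terms agree over nilpotent groups exactly when their reductions agree for every prime
(`value_eq_iff`).

The reduction depends on `p` only through the divisibilities `p ∣ m`, hence is the same for all
primes larger than the exponents in the term, and equals the formal reduction at `p = 0`. Thus
finitely many word problems in a free group suffice (`sameWords_iff`), each solved by a primitive
recursive computation on Gödel numbers. -/

theorem sgPow_eq_pow {M : Type*} [Monoid M] (x : M) {k : ℕ} (hk : 1 ≤ k) : sgPow x k = x ^ k := by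
  induction k, hk using Nat.le_induction with
  | base => exact (pow_one x).symm
  | succ k hk ih => rw [sgPow_succ x hk, ih, pow_succ']

theorem omegaInv_eq_inv {G : Type*} [Group G] [Finite G] (x : G) : omegaInv x = x⁻¹ := by
  have hf := Nat.factorial_pos (Nat.card G)
  have hd : Nat.card G ∣ 2 * (Nat.card G).factorial :=
    (Nat.dvd_factorial Nat.card_pos le_rfl).mul_left 2
  rw [omegaInv, sgPow_eq_pow x (by omega), eq_inv_iff_mul_eq_one, ← pow_succ,
    Nat.sub_add_cancel (by omega)]
  exact orderOf_dvd_iff_pow_eq_one.mp ((orderOf_dvd_natCard x).trans hd)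

/-- Euler's theorem: `φ(|G|) ≤ |G|` divides `|G| !`, so `m ^ |G| !` is `1` modulo `|G|`. -/
theorem powOmega_eq_self {G : Type*} [Group G] [Finite G] {m : ℕ} (hm : 1 ≤ m)
    (h : m.Coprime (Nat.card G)) (x : G) : powOmega m x = x := by
  rw [powOmega, sgPow_eq_pow x (Nat.pow_pos hm)]
  obtain ⟨c, hc⟩ : (Nat.card G).totient ∣ (Nat.card G).factorial :=
    Nat.dvd_factorial (Nat.totient_pos.mpr Nat.card_pos) (Nat.totient_le _)
  have h1 : m ^ (Nat.card G).factorial ≡ 1 [MOD Nat.card G] := by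
    rw [hc, pow_mul]
    simpa using (Nat.ModEq.pow_totient h).pow c
  have h2 := pow_eq_pow_iff_modEq.mpr (h1.of_dvd (orderOf_dvd_natCard x))
  rwa [pow_one] at h2

/-- If `|G| = p ^ r`, then `r ≤ |G| !`, so `|G|` divides `m ^ |G| !`. -/
theorem powOmega_eq_one {G : Type*} [Group G] [Finite G] {p : ℕ} [Fact p.Prime] (hG : IsPGroup p G)
    {m : ℕ} (hm : 1 ≤ m) (h : p ∣ m) (x : G) : powOmega m x = 1 := by
  rw [powOmega, sgPow_eq_pow x (Nat.pow_pos hm)]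
  obtain ⟨r, hr⟩ := IsPGroup.iff_card.mp hG
  have hle : r ≤ (Nat.card G).factorial := by
    have h1 : r < p ^ r := Nat.lt_pow_self (Fact.out : p.Prime).one_lt
    have := Nat.self_le_factorial (Nat.card G)
    omega
  refine orderOf_dvd_iff_pow_eq_one.mp (((orderOf_dvd_natCard x).trans hr.dvd).trans ?_)
  exact (pow_dvd_pow p hle).trans (pow_dvd_pow_of_dvd h _)

/-- An injective idempotent map is the identity. -/
theorem omegaIter_eq_id {X : Type*} [Finite X] {g : X → X} (hg : Injective g) :
    omegaIter g = id := by
  funext x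
  exact (hg.iterate (Nat.card X).factorial) (congrFun (omegaIter_idem g).1 x)

/-! ### Evaluation of `κ`-terms in groups -/

namespace KappaTerm

variable {n : ℕ}

/-- The value of a `κ`-term in a group, where `x ↦ x ^ (ω - 1)` is read as inversion. -/
def groupEval {G : Type*} [Group G] (s : Fin n → G) : KappaTerm n → G
  | letter i => s i
  | mul u v => u.groupEval s * v.groupEval s
  | inv u => (u.groupEval s)⁻¹

theorem map_groupEval {G H : Type*} [Group G] [Group H] (f : G →* H) (s : Fin n → G)
    (w : KappaTerm n) : f (w.groupEval s) = w.groupEval (f ∘ s) := by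
  induction w with
  | letter i => rfl
  | mul u v hu hv => simp only [groupEval, map_mul, hu, hv]
  | inv u hu => simp only [groupEval, map_inv, hu]

theorem groupEval_mem {G : Type*} [Group G] (H : Subgroup G) {s : Fin n → G} (hs : ∀ i, s i ∈ H)
    (w : KappaTerm n) : w.groupEval s ∈ H := by
  induction w with
  | letter i => exact hs i
  | mul u v hu hv => exact H.mul_mem hu hv
  | inv u hu => exact H.inv_mem hu

/-- Values at central tuples are central and can be moved past everything. This isolates the linear
behaviour of terms used in the induction on central quotients. -/
theorem groupEval_mul_center {G : Type*} [Group G] (s z : Fin n → G)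
    (hz : ∀ i, z i ∈ Subgroup.center G) (w : KappaTerm n) :
    w.groupEval (s * z) = w.groupEval s * w.groupEval z := by
  induction w with
  | letter i => rfl
  | mul u v hu hv =>
    have h := Subgroup.mem_center_iff.mp (groupEval_mem _ hz u) (v.groupEval s)
    simp only [groupEval, hu, hv]
    rw [mul_assoc, ← mul_assoc (u.groupEval z), ← h]
    simp only [mul_assoc]
  | inv u hu =>
    have h := Subgroup.mem_center_iff.mp (groupEval_mem _ hz u) (u.groupEval s)
    simp only [groupEval, hu]
    rw [h, mul_inv_rev]

theorem groupEval_eq_prod {Z : Type*} [CommGroup Z] (z : Fin n → Z) (w : KappaTerm n) :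
    w.groupEval z = ∏ j, z j ^ w.expSum j := by
  induction w with
  | letter i =>
    simp only [groupEval, expSum]
    rw [Finset.prod_eq_single i] <;> simp +contextual [eq_comm]
  | mul u v hu hv => simp only [groupEval, expSum, hu, hv, zpow_add, Finset.prod_mul_distrib]
  | inv u hu => simp only [groupEval, expSum, hu, zpow_neg, Finset.prod_inv_distrib]

theorem value_op {G : Type} [Group G] [Finite G] (s : Fin n → G) (w : KappaTerm n) :
    w.value.op ⟨G⟩ trivial s = w.groupEval s := by
  induction w with
  | letter i => rfl
  | mul u v hu hv => exact congrArg₂ (fun x y : G => x * y) hu hv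
  | inv u hu => exact (omegaInv_eq_inv (G := G) _).trans (congrArg (fun x : G => x⁻¹) hu)

end KappaTerm

theorem zpow_sum {Z ι : Type*} [CommGroup Z] (z : Z) (s : Finset ι) (f : ι → ℤ) :
    z ^ ∑ i ∈ s, f i = ∏ i ∈ s, z ^ f i := by
  classical
  induction s using Finset.induction_on with
  | empty => simp
  | insert i s hi ih => rw [Finset.sum_insert hi, Finset.prod_insert hi, zpow_add, ih]

open KappaTerm in
/-- A system of `κ`-terms acts on tuples over an abelian group through its exponent matrix. -/
theorem pow_det_eq_one {Z : Type*} [CommGroup Z] {n : ℕ} (w : Fin n → KappaTerm n) (z : Fin n → Z)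
    (h : ∀ i, (w i).groupEval z = 1) (k : Fin n) : z k ^ (expMatrix w).det = 1 := by
  -- Cramer's rule: the `k`-th row of the adjugate times the exponent matrix is the determinant at
  -- place `k` and zero elsewhere, so `z k ^ det` is a product of powers of the trivial values.
  have hadj : ∀ j, ∑ i, (expMatrix w).adjugate k i * expMatrix w i j
      = if k = j then (expMatrix w).det else 0 := by
    intro j
    have := congrFun (congrFun (Matrix.adjugate_mul (expMatrix w)) k) j
    rw [Matrix.mul_apply] at this
    rw [this, Matrix.smul_apply, Matrix.one_apply]
    simp
  calc z k ^ (expMatrix w).det = ∏ j, z j ^ (if k = j then (expMatrix w).det else 0) := by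
        rw [Finset.prod_eq_single k] <;> simp +contextual [eq_comm]
    _ = ∏ j, ∏ i, z j ^ ((expMatrix w).adjugate k i * expMatrix w i j) := by
        refine Finset.prod_congr rfl fun j _ => ?_
        rw [← hadj]
        exact zpow_sum _ _ _
    _ = ∏ i, (∏ j, z j ^ expMatrix w i j) ^ (expMatrix w).adjugate k i := by
        rw [Finset.prod_comm]
        refine Finset.prod_congr rfl fun i _ => ?_
        rw [← Finset.prod_zpow]
        refine Finset.prod_congr rfl fun j _ => ?_
        rw [mul_comm, zpow_mul]
    _ = 1 := by
        refine Finset.prod_eq_one fun i _ => ?_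
        have := h i
        rw [groupEval_eq_prod] at this
        rw [show (∏ j, z j ^ expMatrix w i j) = 1 from this, one_zpow]

open KappaTerm IsMulCommutative in
/-- On a finite nilpotent group of order prime to the determinant of the exponent matrix, a system
of `κ`-terms induces an injective operator. -/
theorem groupEval_injective {n : ℕ} (w : Fin n → KappaTerm n) (G : Type*) [Group G]
    [Group.IsNilpotent G] [Finite G] (hG : (expMatrix w).det.natAbs.Coprime (Nat.card G)) :
    Injective fun (s : Fin n → G) i => (w i).groupEval s := by
  suffices H : Finite G → (expMatrix w).det.natAbs.Coprime (Nat.card G) →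
      Injective fun (s : Fin n → G) i => (w i).groupEval s from H ‹_› hG
  clear hG
  revert ‹Finite G›
  intro _
  -- Induction on central quotients; finiteness and coprimality sit in the motive because they must
  -- pass to the quotient.
  refine Group.nilpotent_center_quotient_ind (P := fun G _ _ => Finite G →
      (expMatrix w).det.natAbs.Coprime (Nat.card G) →
      Injective fun (s : Fin n → G) i => (w i).groupEval s) G ?_ ?_
  · intro G _ _ _ _ s t _
    exact Subsingleton.elim s t
  · intro G _ _ ih hfin hG s t hst
    have hq : QuotientGroup.mk' (Subgroup.center G) ∘ s
        = QuotientGroup.mk' (Subgroup.center G) ∘ t := by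
      refine ih inferInstance (hG.coprime_dvd_right (Subgroup.card_quotient_dvd_card _)) ?_
      funext i
      simp only [← map_groupEval]
      exact congrArg _ (congrFun hst i)
    -- By induction the tuples agree modulo the center, so they differ by a central tuple `z` on
    -- which all the terms vanish. The order of each `z k` then divides both the determinant and
    -- `|G|`.
    have hz : ∀ i, (s i)⁻¹ * t i ∈ Subgroup.center G := fun i =>
      QuotientGroup.eq.mp (congrFun hq i)
    let z : Fin n → Subgroup.center G := fun i => ⟨_, hz i⟩
    have ht : t = s * (Subgroup.center G).subtype ∘ z := by
      funext i
      simp [z]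
    have h1 : ∀ i, (w i).groupEval z = 1 := by
      intro i
      have h2 := congrFun hst i
      simp only [ht] at h2
      rw [groupEval_mul_center s ((Subgroup.center G).subtype ∘ z) fun i => (z i).2, left_eq_mul, ← map_groupEval] at h2
      exact Subtype.ext h2
    have h3 : ∀ k, z k = 1 := by
      intro k
      have h4 := pow_det_eq_one w z h1 k
      rw [← orderOf_dvd_iff_zpow_eq_one, ← Int.dvd_natAbs, Int.natCast_dvd_natCast] at h4
      have h5 : orderOf (z k) ∣ Nat.card G :=
        (orderOf_dvd_natCard _).trans (Subgroup.card_subgroup_dvd_card _)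
      exact orderOf_eq_one_iff.mp (Nat.eq_one_of_dvd_coprimes hG h4 h5)
    rw [ht]
    funext k
    simp [h3 k]

theorem omegaInvOp_op {G : Type} [Group G] [Finite G] (s : Fin 1 → G) :
    omegaInvOp.op ⟨G⟩ trivial s = ((s 0)⁻¹ : G) := omegaInv_eq_inv (G := G) _

theorem operator_value {G : Type} [Group G] [Finite G] {n : ℕ} (w : Fin n → KappaTerm n) :
    operator (fun i => (w i).value) ⟨G⟩ = fun (s : Fin n → G) i => (w i).groupEval s := by
  funext s i
  exact KappaTerm.value_op s (w i)

-- Since `m` absorbs all primes of the determinant, `p ∤ m` makes both of them prime to `|G|`, and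
-- neither iterating the operator nor taking the power changes anything.
open Classical in
theorem opOmega_op {p : ℕ} [Fact p.Prime] {G : Type} [Group G] [Finite G] (hG : IsPGroup p G)
    {n : ℕ} (w : Fin n → KappaTerm n) (j : Fin n) {m : ℕ} (hm : 1 ≤ m)
    (hdiv : ∀ p : ℕ, p.Prime → (p : ℤ) ∣ (expMatrix w).det → p ∣ m) (s : Fin n → G) :
    (ImplicitOp.opOmega (fun i => (w i).value) j m hm).op ⟨G⟩ trivial s
      = if p ∣ m then (1 : G) else s j := by
  have hp : p.Prime := Fact.out
  change powOmega (S := G) m (omegaIter (operator (fun i => (w i).value) ⟨G⟩) s j) = _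
  split_ifs with h
  · exact powOmega_eq_one hG hm h _
  · have := hG.isNilpotent
    obtain ⟨r, hr⟩ := IsPGroup.iff_card.mp hG
    have hdet : (expMatrix w).det.natAbs.Coprime (Nat.card G) := by
      rw [hr]
      refine Nat.Coprime.pow_right _ (Nat.Coprime.symm ((Nat.Prime.coprime_iff_not_dvd hp).mpr ?_))
      exact fun hd => h (hdiv p hp (Int.natCast_dvd.mpr hd))
    have hmc : m.Coprime (Nat.card G) := by
      rw [hr]
      exact Nat.Coprime.pow_right _ (Nat.Coprime.symm ((Nat.Prime.coprime_iff_not_dvd hp).mpr h))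
    rw [powOmega_eq_self hm hmc, operator_value]
    have hid := omegaIter_eq_id (groupEval_injective w G hdet)
    exact congrFun (congrFun hid s) j

/-! ### Free groups are residually finite `p`-groups -/

/-- Every element of a free group is a product of non-trivial powers of letters in which
consecutive letters are distinct. -/
theorem exists_syllables {A : Type*} (w : FreeGroup A) :
    ∃ l : List (A × ℤ), (∀ x ∈ l, x.2 ≠ 0) ∧ l.IsChain (fun x y => x.1 ≠ y.1) ∧
      (l.map fun x => FreeGroup.of x.1 ^ x.2).prod = w := by
  classical
  -- A free group is a free product of infinite cyclic groups; the syllables are read off the normal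
  -- form there.
  let v := Monoid.CoprodI.Word.equiv (freeGroupEquivCoprodI w)
  let F : (Σ _ : A, FreeGroup Unit) → A × ℤ := fun x => (x.1, FreeGroup.freeGroupUnitEquivInt x.2)
  refine ⟨v.toList.map F, ?_, ?_, ?_⟩
  · intro x hx
    obtain ⟨y, hy, rfl⟩ := List.mem_map.mp hx
    intro h
    refine v.ne_one y hy (FreeGroup.freeGroupUnitEquivInt.injective (h.trans ?_))
    rfl
  · exact (List.isChain_map F).mpr v.chain_ne
  · have hv : v.prod = freeGroupEquivCoprodI w := Monoid.CoprodI.Word.equiv.symm_apply_apply _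
    have hw : freeGroupEquivCoprodI.symm v.prod = w := by
      rw [hv]
      exact freeGroupEquivCoprodI.symm_apply_apply w
    rw [← hw, Monoid.CoprodI.Word.prod, map_list_prod, List.map_map, List.map_map]
    congr 2
    funext x
    have h1 : FreeGroup.of () ^ (FreeGroup.freeGroupUnitEquivInt x.2) = x.2 :=
      FreeGroup.freeGroupUnitEquivInt.symm_apply_apply x.2
    have h2 : freeGroupEquivCoprodI.symm
        (Monoid.CoprodI.of (M := fun _ : A => FreeGroup Unit) (i := x.1) x.2)
        = FreeGroup.lift (fun _ => FreeGroup.of x.1) x.2 :=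
      Monoid.CoprodI.lift_of (M := fun _ : A => FreeGroup Unit)
        (fun i => FreeGroup.lift fun _ => FreeGroup.of i) x.2
    simp only [Function.comp_apply, F]
    rw [h2]
    conv_rhs => rw [← h1, map_zpow, FreeGroup.lift_apply_of]

/-- The one-parameter group `e ↦ 1 + e x` for an element `x` with square zero. -/
def unipotentHom {R : Type*} [Ring R] (x : R) (hx : x * x = 0) : Multiplicative ℤ →* Rˣ :=
  MonoidHom.toHomUnits
    { toFun := fun e => 1 + e.toAdd • x
      map_one' := by simp
      map_mul' := fun e f => by
        rw [toAdd_mul, add_smul, mul_add, add_mul, add_mul, smul_mul_smul_comm, hx]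
        simp [add_assoc] }

/-- Truncated binomial expansion. That `q` commutes with `x` is needed to compute powers of the
remainder. -/
theorem one_add_pow_eq {R : Type*} [Ring R] (x : R) (n : ℕ) :
    ∃ q : R, Commute x q ∧ (1 + x) ^ n = 1 + n * x + x ^ 2 * q := by
  induction n with
  | zero => exact ⟨0, Commute.zero_right x, by simp⟩
  | succ n ih =>
    obtain ⟨q, hq, h⟩ := ih
    refine ⟨n + q * (1 + x), ?_, ?_⟩
    · exact (Nat.commute_cast x n).add_right
        (hq.mul_right ((Commute.one_right x).add_right (Commute.refl x)))
    · rw [pow_succ, h]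
      have hn : (n : R) * x = x * n := Nat.cast_commute n x
      push_cast
      simp only [mul_add, add_mul, mul_one, one_mul, hn, pow_two, mul_assoc]
      abel

/-- In a ring of characteristic dividing `p ^ N`, unipotent elements have `p`-power order. -/
theorem exists_pow_eq_one_of_nilpotent {R : Type*} [Ring R] {p N : ℕ} (hp : (p : R) ^ N = 0) {x : R}
    (hx : IsNilpotent x) : ∃ k, (1 + x) ^ p ^ k = 1 := by
  -- Raising to the power `p ^ N` kills the linear term and leaves `1 + x ^ 2 * q`, whose nilpotent
  -- part already vanishes at half the exponent; hence the induction over powers of two.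
  have key : ∀ s : ℕ, ∀ x : R, x ^ 2 ^ s = 0 → ∃ k, (1 + x) ^ p ^ k = 1 := by
    intro s
    induction s with
    | zero =>
      intro x hx
      refine ⟨0, ?_⟩
      rw [pow_zero, pow_one] at hx
      simp [hx]
    | succ s ih =>
      intro x hx
      obtain ⟨q, hq, h⟩ := one_add_pow_eq x (p ^ N)
      rw [Nat.cast_pow, hp, zero_mul, add_zero] at h
      obtain ⟨k, hk⟩ := ih (x ^ 2 * q) (by
        rw [(hq.pow_left 2).mul_pow, ← pow_mul, ← pow_succ', hx, zero_mul])
      exact ⟨N + k, by rw [pow_add, pow_mul, h, hk]⟩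
  obtain ⟨n, hn⟩ := hx
  refine key n x ?_
  exact pow_eq_zero_of_le (Nat.lt_two_pow_self).le hn

/-! ### Unitriangular matrices -/

namespace StrictlyUpper

variable {R : Type*} [Ring R] {k : ℕ}

/-- Entries vanish on and below the `s`-th superdiagonal, exclusive. -/
def Above (s : ℕ) (M : Matrix (Fin k) (Fin k) R) : Prop := ∀ i j : Fin k, (j : ℕ) < i + s → M i j = 0

theorem Above.mul {s t : ℕ} {M N : Matrix (Fin k) (Fin k) R} (hM : Above s M) (hN : Above t N) :
    Above (s + t) (M * N) := by
  intro i j hij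
  rw [Matrix.mul_apply]
  refine Finset.sum_eq_zero fun m _ => ?_
  by_cases h : (m : ℕ) < i + s
  · rw [hM i m h, zero_mul]
  · rw [hN m j (by omega), mul_zero]

theorem Above.mono {s t : ℕ} (h : s ≤ t) {M : Matrix (Fin k) (Fin k) R} (hM : Above t M) :
    Above s M := fun i j hij => hM i j (by omega)

theorem Above.add {s : ℕ} {M N : Matrix (Fin k) (Fin k) R} (hM : Above s M) (hN : Above s N) :
    Above s (M + N) := fun i j hij => by rw [Matrix.add_apply, hM i j hij, hN i j hij, add_zero]

theorem Above.neg {s : ℕ} {M : Matrix (Fin k) (Fin k) R} (hM : Above s M) :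
    Above s (-M) := fun i j hij => by rw [Matrix.neg_apply, hM i j hij, neg_zero]

theorem above_one : Above 0 (1 : Matrix (Fin k) (Fin k) R) := fun i j hij =>
  Matrix.one_apply_ne (by rintro rfl; omega)

theorem Above.pow {M : Matrix (Fin k) (Fin k) R} (hM : Above 1 M) (s : ℕ) : Above s (M ^ s) := by
  induction s with
  | zero => rw [pow_zero]; exact above_one
  | succ s ih => rw [pow_succ]; exact ih.mul hM

theorem Above.isNilpotent {M : Matrix (Fin k) (Fin k) R} (hM : Above 1 M) : IsNilpotent M :=
  ⟨k, by ext i j; exact hM.pow k i j (by omega)⟩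

theorem above_mul_sub_one {M N : Matrix (Fin k) (Fin k) R} (hM : Above 1 (M - 1))
    (hN : Above 1 (N - 1)) : Above 1 (M * N - 1) := by
  have h : M * N - 1 = (M - 1) * (N - 1) + ((M - 1) + (N - 1)) := by
    simp only [sub_mul, mul_sub, mul_one, one_mul]
    abel
  rw [h]
  exact ((hM.mul hN).mono (by omega)).add (hM.add hN)

/-- The matrix with entries `1` at those places `(i, i + 1)` for which the `i`-th syllable is a
power of `a`. -/
def shift {A : Type*} [DecidableEq A] (R : Type*) [Ring R] (l : List (A × ℤ)) (a : A) :
    Matrix (Fin (l.length + 1)) (Fin (l.length + 1)) R :=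
  Matrix.of fun i j => if (j : ℕ) = i + 1 ∧ (l[(i : ℕ)]?).map Prod.fst = some a then 1 else 0

variable {A : Type*} [DecidableEq A] (l : List (A × ℤ))

theorem above_shift (a : A) : Above 1 (shift R l a) := by
  intro i j hij
  rw [shift, Matrix.of_apply, if_neg (by omega)]

/-- A nonzero term of the product would need two consecutive syllables in the same letter. -/
theorem shift_mul_shift (hl : l.IsChain (fun x y => x.1 ≠ y.1)) (a : A) :
    shift R l a * shift R l a = 0 := by
  ext i j
  rw [Matrix.mul_apply]
  refine Finset.sum_eq_zero fun m _ => ?_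
  simp only [shift, Matrix.of_apply]
  by_cases h1 : (m : ℕ) = i + 1 ∧ (l[(i : ℕ)]?).map Prod.fst = some a
  · by_cases h2 : (j : ℕ) = m + 1 ∧ (l[(m : ℕ)]?).map Prod.fst = some a
    · exfalso
      obtain ⟨x, hx, hxa⟩ := Option.map_eq_some_iff.mp h1.2
      obtain ⟨y, hy, hya⟩ := Option.map_eq_some_iff.mp h2.2
      rw [h1.1] at hy
      obtain ⟨hi, rfl⟩ := List.getElem?_eq_some_iff.mp hx
      obtain ⟨hi', rfl⟩ := List.getElem?_eq_some_iff.mp hy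
      exact List.isChain_iff_getElem.mp hl i hi' (hxa.trans hya.symm)
    · rw [if_neg h2, mul_zero]
  · rw [if_neg h1, zero_mul]

/-- The first row of the product of the matrices of the first `t` syllables. -/
theorem prod_take_apply (R : Type*) [Ring R] (l : List (A × ℤ)) (t : ℕ) (ht : t ≤ l.length) :
    (∀ j : Fin (l.length + 1), t < j →
      (((l.map fun x : A × ℤ => 1 + x.2 • shift R l x.1).take t).prod) 0 j = 0) ∧
    (((l.map fun x : A × ℤ => 1 + x.2 • shift R l x.1).take t).prod) 0 ⟨t, by omega⟩
      = (((l.map Prod.snd).take t).prod : ℤ) := by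
  induction t with
  | zero =>
    refine ⟨fun j hj => ?_, ?_⟩
    · simp only [List.take_zero, List.prod_nil]
      exact Matrix.one_apply_ne (by rintro rfl; simp at hj)
    · simp only [List.take_zero, List.prod_nil, Int.cast_one]
      exact Matrix.one_apply_eq _
  | succ t ih =>
    obtain ⟨ih1, ih2⟩ := ih (by omega)
    rw [List.prod_take_succ _ t (by simpa using ht), List.prod_take_succ _ t (by simpa using ht)]
    simp only [List.getElem_map]
    generalize ((l.map fun x : A × ℤ => 1 + x.2 • shift R l x.1).take t).prod = P at ih1 ih2 ⊢
    -- The next factor adds to a column at most a multiple of the preceding one, so the support of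
    -- the first row grows by at most one place per syllable.
    have hexp : ∀ j, (P * (1 + l[t].2 • shift R l l[t].1)) 0 j
        = P 0 j + l[t].2 • ∑ m, P 0 m * shift R l l[t].1 m j := by
      intro j
      rw [mul_add, mul_one, Matrix.add_apply, mul_smul_comm, Matrix.smul_apply, Matrix.mul_apply]
    refine ⟨fun j hj => ?_, ?_⟩
    · rw [hexp, ih1 j (by omega), Finset.sum_eq_zero, smul_zero, add_zero]
      intro m _
      by_cases hm : (j : ℕ) = m + 1
      · rw [ih1 m (by omega), zero_mul]
      · rw [shift, Matrix.of_apply, if_neg (fun h => hm h.1), mul_zero]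
    · rw [hexp, ih1 _ (by simp), Finset.sum_eq_single ⟨t, by omega⟩, ih2, shift, Matrix.of_apply,
        if_pos ⟨rfl, by simp [List.getElem?_eq_getElem (show t < l.length by omega)]⟩]
      · simp only [mul_one, zero_add, zsmul_eq_mul, Int.cast_mul]
        exact Int.cast_commute _ _
      · intro m _ hm
        rw [shift, Matrix.of_apply, if_neg, mul_zero]
        rintro ⟨h, -⟩
        exact hm (Fin.ext (by simpa using h.symm))
      · simp

end StrictlyUpper

-- Send each letter `a` to `1 + shift a` over `ℤ / p ^ |e|`, where `e` is the product of the
-- exponents of the syllables of `w`. The image is unitriangular, hence a `p`-group, and the top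
-- right entry of the image of `w` is `e`, which is nonzero there because `0 < |e| < p ^ |e|`.
open StrictlyUpper in
theorem exists_isPGroup_hom_ne_one {A : Type*} (p : ℕ) [Fact p.Prime] {w : FreeGroup A}
    (hw : w ≠ 1) : ∃ (G : Type) (_ : Group G) (_ : Finite G) (f : FreeGroup A →* G),
      IsPGroup p G ∧ f w ≠ 1 := by
  classical
  have hp : p.Prime := Fact.out
  obtain ⟨l, hne, hchain, hprod⟩ := exists_syllables w
  have he : (l.map Prod.snd).prod ≠ 0 := by
    rw [Ne, List.prod_eq_zero_iff]
    rintro h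
    obtain ⟨x, hx, hx0⟩ := List.mem_map.mp h
    exact hne x hx hx0
  set e := (l.map Prod.snd).prod with hedef
  let R := ZMod (p ^ e.natAbs)
  have : NeZero (p ^ e.natAbs) := ⟨pow_ne_zero _ hp.ne_zero⟩
  let U : A → Multiplicative ℤ →* (Matrix (Fin (l.length + 1)) (Fin (l.length + 1)) R)ˣ :=
    fun a => unipotentHom (shift R l a) (shift_mul_shift l hchain a)
  have hU : ∀ a m, (U a (.ofAdd m)).val = 1 + m • shift R l a :=
    fun _ _ => rfl
  let f : FreeGroup A →* (Matrix (Fin (l.length + 1)) (Fin (l.length + 1)) R)ˣ :=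
    FreeGroup.lift fun a => U a (.ofAdd 1)
  have hf : ∀ a (m : ℤ), f (FreeGroup.of a ^ m) = U a (.ofAdd m) := by
    intro a m
    rw [map_zpow, FreeGroup.lift_apply_of, ← map_zpow, ← ofAdd_zsmul, smul_eq_mul, mul_one]
  have hup : ∀ v, Above 1 ((f v).val - 1) := by
    intro v
    induction v using FreeGroup.induction_on with
    | C1 => rw [map_one, Units.val_one, sub_self]; exact fun _ _ _ => rfl
    | of a =>
      rw [← zpow_one (FreeGroup.of a), hf, hU, one_smul, add_sub_cancel_left]
      exact above_shift l a
    | inv_of a _ =>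
      rw [← zpow_neg_one, hf, hU, neg_smul, one_smul, add_sub_cancel_left]
      exact (above_shift l a).neg
    | mul u v hu hv => rw [map_mul, Units.val_mul]; exact above_mul_sub_one hu hv
  refine ⟨f.range, inferInstance, inferInstance, f.rangeRestrict, ?_, ?_⟩
  · rintro ⟨_, v, rfl⟩
    have hR : ((p : ℕ) : Matrix (Fin (l.length + 1)) (Fin (l.length + 1)) R) ^ e.natAbs = 0 := by
      rw [← Nat.cast_pow, ← map_natCast (algebraMap R _), ZMod.natCast_self, map_zero]
    obtain ⟨k, hk⟩ := exists_pow_eq_one_of_nilpotent hR (hup v).isNilpotent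
    refine ⟨k, Subtype.ext (Units.ext ?_)⟩
    rw [add_sub_cancel] at hk
    exact hk
  · intro h
    have h1 : f w = 1 := congrArg Subtype.val h
    have h2 : (f w).val
        = ((l.map fun x : A × ℤ => 1 + x.2 • shift R l x.1).take l.length).prod := by
      rw [List.take_of_length_le (by simp), ← hprod, map_list_prod, List.map_map]
      rw [← Units.coeHom_apply, map_list_prod, List.map_map]
      congr 2
      funext x
      simp only [Function.comp_apply, hf, Units.coeHom_apply, hU]
    have h3 := (prod_take_apply R l l.length le_rfl).2
    rw [← h2, h1, List.take_of_length_le (by simp), ← hedef, Units.val_one, Matrix.one_apply_ne] at h3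
    · have h4 := (ZMod.intCast_zmod_eq_zero_iff_dvd e (p ^ e.natAbs)).mp h3.symm
      have h5 := Nat.le_of_dvd (Int.natAbs_pos.mpr he) (Int.natCast_dvd.mp h4)
      exact absurd (Nat.lt_pow_self hp.one_lt) (not_lt.mpr h5)
    -- The corner lies on the diagonal only when there are no syllables, and then `w = 1`.
    · intro h0
      have : l.length = 0 := (congrArg Fin.val h0).symm
      rw [List.length_eq_zero_iff] at this
      exact hw (by rw [← hprod, this]; rfl)

/-! ### Reduction of `σ`-terms to group words -/

open Classical in
/-- The operation on groups that a symbol of `σ` induces on finite `p`-groups. -/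
noncomputable def SigmaSymbol.groupOp {G : Type*} [Group G] (p : ℕ) :
    (f : SigmaSymbol) → (Fin f.arity → G) → G
  | mul => fun s : Fin 2 → G => s 0 * s 1
  | inv => fun s : Fin 1 → G => (s 0)⁻¹
  | opOmega n _ j m _ _ _ => fun s : Fin n → G => if p ∣ m then 1 else s j

theorem SigmaSymbol.map_groupOp {G H : Type*} [Group G] [Group H] (g : G →* H) (p : ℕ)
    (f : SigmaSymbol) (s : Fin f.arity → G) : g (f.groupOp p s) = f.groupOp p (g ∘ s) := by
  cases f with
  | mul => exact map_mul g _ _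
  | inv => exact map_inv g _
  | opOmega n w j m _ _ _ =>
    simp only [groupOp]
    split_ifs
    · exact map_one g
    · rfl

theorem SigmaSymbol.value_op {p : ℕ} [Fact p.Prime] {G : Type} [Group G] [Finite G]
    (hG : IsPGroup p G) (f : SigmaSymbol) (s : Fin f.arity → G) :
    f.value.op ⟨G⟩ trivial s = f.groupOp p s := by
  cases f with
  | mul => rfl
  | inv => exact omegaInvOp_op s
  | opOmega n w j m hm hdet hdiv => exact opOmega_op hG w j hm hdiv s

namespace SigmaTerm

variable {A : Type*}

/-- The element of the free group to which a `σ`-term reduces over finite `p`-groups. -/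
noncomputable def toFreeGroup (p : ℕ) : SigmaTerm A → FreeGroup A
  | letter a => FreeGroup.of a
  | app f u => f.groupOp p fun i => (u i).toFreeGroup p

/-- Each symbol acts on `p`-groups as its `groupOp`, and `groupOp` commutes with the homomorphism
`FreeGroup.lift φ`. -/
theorem eval_eq_lift {p : ℕ} [Fact p.Prime] {G : Type} [Group G] [Finite G] (hG : IsPGroup p G)
    {V : Set FinSemigroup} (hV : (⟨G⟩ : FinSemigroup) ∈ V) (φ : A → G) (t : SigmaTerm A) :
    (t.eval V).op ⟨G⟩ hV φ = FreeGroup.lift φ (t.toFreeGroup p) := by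
  induction t with
  | letter a => exact (FreeGroup.lift_apply_of).symm
  | app f u ih =>
    rw [toFreeGroup, SigmaSymbol.map_groupOp, ← SigmaSymbol.value_op hG]
    exact congrArg (f.value.op ⟨G⟩ trivial) (funext ih)

/-- A bound for the exponents `m` of the operations that occur in a term. -/
theorem le_code {n : ℕ} {w : Fin n → KappaTerm n} {j : Fin n} {m : ℕ} {hm hdet hdiv} :
    m ≤ (SigmaSymbol.opOmega n w j m hm hdet hdiv).code := by
  simp only [SigmaSymbol.code]
  refine le_trans ?_ (Nat.le_add_left _ _)
  exact (Nat.left_le_pair _ _).trans (Nat.right_le_pair _ _)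

end SigmaTerm

theorem le_encode_of_mem {c : ℕ} : ∀ {l : List ℕ}, c ∈ l → c ≤ Encodable.encode l
  | a :: l, h => by
    rw [Encodable.encode_list_cons]
    rcases List.mem_cons.mp h with rfl | h
    · exact (Nat.left_le_pair _ _).trans (Nat.le_succ _)
    · exact (le_encode_of_mem h).trans ((Nat.right_le_pair _ _).trans (Nat.le_succ _))

namespace SigmaTerm

variable {A : Type*} [Encodable A]

theorem symbol_code_lt (f : SigmaSymbol) (u : Fin f.arity → SigmaTerm A) :
    f.code < (app f u).code := by
  have h1 := Nat.left_le_pair f.code (Encodable.encode (List.ofFn fun i => (u i).code))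
  have h2 := Nat.add_le_pair 1
    (Nat.pair f.code (Encodable.encode (List.ofFn fun i => (u i).code)))
  rw [code]
  omega

/-- This makes recursion on Gödel numbers legitimate: the words of the arguments are already
tabulated. -/
theorem arg_code_lt (f : SigmaSymbol) (u : Fin f.arity → SigmaTerm A) (i : Fin f.arity) :
    (u i).code < (app f u).code := by
  have h : (u i).code ≤ Encodable.encode (List.ofFn fun i => (u i).code) :=
    le_encode_of_mem (List.mem_ofFn.mpr ⟨i, rfl⟩)
  have h1 := Nat.right_le_pair f.code (Encodable.encode (List.ofFn fun i => (u i).code))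
  have h2 := Nat.add_le_pair 1
    (Nat.pair f.code (Encodable.encode (List.ofFn fun i => (u i).code)))
  rw [code]
  omega

/-- Every exponent satisfies `1 ≤ m < p`, so `p ∤ m`; also `0 ∤ m`. Hence `0` stands for all large
primes at once. -/
theorem toFreeGroup_eq_of_code_lt {p : ℕ} (t : SigmaTerm A) (h : t.code < p) :
    t.toFreeGroup p = t.toFreeGroup 0 := by
  induction t with
  | letter a => rfl
  | app f u ih =>
    have hu : (fun i => (u i).toFreeGroup p) = fun i => (u i).toFreeGroup 0 :=
      funext fun i => ih i ((arg_code_lt f u i).trans h)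
    have hf := (symbol_code_lt f u).trans h
    rw [toFreeGroup, toFreeGroup, hu]
    cases f with
    | mul => rfl
    | inv => rfl
    | opOmega n w j m hm hdet hdiv =>
      have h1 : ¬ p ∣ m := fun hd =>
        absurd (Nat.le_of_dvd hm hd) (not_le.mpr (lt_of_le_of_lt le_code hf))
      have h2 : ¬ 0 ∣ m := fun hd => by simp at hd; omega
      simp only [SigmaSymbol.groupOp]
      rw [if_neg h1, if_neg h2]

end SigmaTerm

/-! ### The algorithm -/

/-- Group words over the letters `0, 1, 2, ...`. -/
abbrev NatWord := List (ℕ × Bool)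

/-- The inverse of a group word. -/
def invWord (w : NatWord) : NatWord := (w.map fun x => (x.1, !x.2)).reverse

/-- The group word of the term with Gödel number `h.length`, where `h` lists the group words of all
smaller numbers. -/
def wordStep (p : ℕ) (h : List NatWord) : NatWord :=
  let x := h.length.unpair
  let f := x.2.unpair.1
  let args := (Encodable.decode (α := List ℕ) x.2.unpair.2).getD []
  let arg := fun i => h.getD (args.getD i 0) []
  if x.1 = 0 then [(x.2, true)]
  else if f = 0 then arg 0 ++ arg 1
  else if f = 1 then invWord (arg 0)
  -- This is the exponent `m`. For `p = 0` the convention `m % 0 = m` makes the test fail for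
  -- genuine symbols, as required.
  else if (f - 2).unpair.2.unpair.1 % p = 0 then []
  else arg (f - 2).unpair.1

/-- The group words of the terms with Gödel numbers less than `n`. -/
def wordList (p : ℕ) : ℕ → List NatWord
  | 0 => []
  | n + 1 => wordList p n ++ [wordStep p (wordList p n)]

/-- The group word of the term with Gödel number `n`. -/
def codeWord (p n : ℕ) : NatWord := wordStep p (wordList p n)

theorem length_wordList (p n : ℕ) : (wordList p n).length = n := by
  induction n with
  | zero => rfl
  | succ n ih => rw [wordList, List.length_append, ih]; rfl

theorem getD_wordList (p : ℕ) {c n : ℕ} (h : c < n) :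
    (wordList p n).getD c [] = codeWord p c := by
  induction n with
  | zero => omega
  | succ n ih =>
    rw [wordList]
    rcases Nat.lt_succ_iff_lt_or_eq.mp h with h | rfl
    · rw [List.getD_append _ _ _ _ (by rwa [length_wordList]), ih h]
    · rw [List.getD_append_right _ _ _ _ (length_wordList p c).le, length_wordList, Nat.sub_self]
      rfl

theorem mk_invWord (w : NatWord) : FreeGroup.mk (invWord w) = (FreeGroup.mk w)⁻¹ := rfl

-- Correctness of the table: it computes the reduction, with each letter renamed to its code.
open SigmaTerm in
theorem mk_codeWord {A : Type*} [Encodable A] (p : ℕ) (t : SigmaTerm A) :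
    FreeGroup.mk (codeWord p t.code) = FreeGroup.map Encodable.encode (t.toFreeGroup p) := by
  induction t with
  | letter a => simp [codeWord, wordStep, length_wordList, code, toFreeGroup, FreeGroup.of]
  | app f u ih =>
    have harg : ∀ i : Fin f.arity, (wordList p (app f u).code).getD
        ((List.ofFn fun i => (u i).code).getD i 0) [] = codeWord p (u i).code := by
      intro i
      rw [← getD_wordList p (arg_code_lt f u i)]
      congr 1
      simp [List.getD]
    have hstep : codeWord p (app f u).code =
        if f.code = 0 then
          (wordList p (app f u).code).getD ((List.ofFn fun i => (u i).code).getD 0 0) [] ++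
          (wordList p (app f u).code).getD ((List.ofFn fun i => (u i).code).getD 1 0) []
        else if f.code = 1 then invWord
          ((wordList p (app f u).code).getD ((List.ofFn fun i => (u i).code).getD 0 0) [])
        else if (f.code - 2).unpair.2.unpair.1 % p = 0 then []
        else (wordList p (app f u).code).getD
          ((List.ofFn fun i => (u i).code).getD (f.code - 2).unpair.1 0) [] := by
      rw [codeWord, wordStep, length_wordList]
      simp only [show (app f u).code.unpair = (1, Nat.pair f.code
        (Encodable.encode (List.ofFn fun i => (u i).code))) by rw [code, Nat.unpair_pair],
        Nat.unpair_pair, Encodable.encodek, Option.getD_some, one_ne_zero, if_false]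
    have hmk : ∀ i : Fin f.arity, FreeGroup.mk ((wordList p (app f u).code).getD
        ((List.ofFn fun i => (u i).code).getD i 0) [])
        = FreeGroup.map Encodable.encode ((u i).toFreeGroup p) :=
      fun i => (congrArg FreeGroup.mk (harg i)).trans (ih i)
    rw [hstep]
    cases f with
    | mul =>
      have h0 := hmk (0 : Fin 2)
      have h1 := hmk (1 : Fin 2)
      rw [if_pos (show SigmaSymbol.mul.code = 0 from rfl), ← FreeGroup.mul_mk]
      exact (congrArg₂ (· * ·) h0 h1).trans (map_mul _ _ _).symm
    | inv =>
      have h0 := hmk (0 : Fin 1)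
      rw [if_neg (show SigmaSymbol.inv.code ≠ 0 from one_ne_zero),
        if_pos (show SigmaSymbol.inv.code = 1 from rfl), mk_invWord]
      exact (congrArg _ h0).trans (map_inv _ _).symm
    | opOmega n w j m hm hdet hdiv =>
      have hj := hmk j
      have e : (SigmaSymbol.opOmega n w j m hm hdet hdiv).code - 2 = Nat.pair j (Nat.pair m
          (Encodable.encode (List.ofFn fun i => (w i).code))) := Nat.add_sub_cancel_left ..
      have h2 : 2 ≤ (SigmaSymbol.opOmega n w j m hm hdet hdiv).code := Nat.le_add_right _ _
      rw [if_neg (by omega), if_neg (by omega), e]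
      simp only [Nat.unpair_pair, toFreeGroup, SigmaSymbol.groupOp, ← Nat.dvd_iff_mod_eq_zero]
      split_ifs
      · exact (map_one _).symm
      · exact hj

/-! ### Primitive recursiveness -/

theorem primrec_invWord : Primrec invWord :=
  Primrec.list_reverse.comp (Primrec.list_map Primrec.id
    (Primrec.pair (Primrec.fst.comp Primrec.snd) (Primrec.not.comp (Primrec.snd.comp Primrec.snd))))

theorem primrec_wordStep : Primrec₂ wordStep := by
  have hx : Primrec fun a : ℕ × List NatWord => a.2.length.unpair :=
    Primrec.unpair.comp (Primrec.list_length.comp Primrec.snd)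
  have hy : Primrec fun a : ℕ × List NatWord => a.2.length.unpair.2.unpair :=
    Primrec.unpair.comp (Primrec.snd.comp hx)
  have hf := Primrec.fst.comp hy
  have hg : Primrec fun a : ℕ × List NatWord => (a.2.length.unpair.2.unpair.1 - 2).unpair :=
    Primrec.unpair.comp (Primrec.nat_sub.comp hf (Primrec.const 2))
  have hargs : Primrec fun a : ℕ × List NatWord =>
      (Encodable.decode (α := List ℕ) a.2.length.unpair.2.unpair.2).getD [] :=
    Primrec.option_getD.comp (Primrec.decode.comp (Primrec.snd.comp hy)) (Primrec.const [])
  have harg : ∀ {i : ℕ × List NatWord → ℕ}, Primrec i → Primrec fun a : ℕ × List NatWord =>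
      a.2.getD (((Encodable.decode (α := List ℕ)
        a.2.length.unpair.2.unpair.2).getD []).getD (i a) 0) [] := fun hi =>
    (Primrec.list_getD []).comp Primrec.snd ((Primrec.list_getD 0).comp hargs hi)
  refine Primrec.ite (Primrec.eq.comp (Primrec.fst.comp hx) (Primrec.const 0))
    (Primrec.list_cons.comp (Primrec.pair (Primrec.snd.comp hx) (Primrec.const true))
      (Primrec.const [])) ?_
  refine Primrec.ite (Primrec.eq.comp hf (Primrec.const 0))
    (Primrec.list_append.comp (harg (Primrec.const 0)) (harg (Primrec.const 1))) ?_
  refine Primrec.ite (Primrec.eq.comp hf (Primrec.const 1))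
    (primrec_invWord.comp (harg (Primrec.const 0))) ?_
  refine Primrec.ite (Primrec.eq.comp (Primrec.nat_mod.comp
    (Primrec.fst.comp (Primrec.unpair.comp (Primrec.snd.comp hg))) Primrec.fst) (Primrec.const 0))
    (Primrec.const []) (harg (Primrec.fst.comp hg))

/-- Course-of-values recursion becomes ordinary recursion on the table of earlier values. -/
theorem primrec_codeWord : Primrec₂ codeWord := by
  have h : Primrec₂ wordList := by
    have h1 : Primrec₂ fun (p : ℕ) (x : ℕ × List NatWord) => x.2 ++ [wordStep p x.2] :=
      Primrec.list_append.comp (Primrec.snd.comp Primrec.snd)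
        (Primrec.list_cons.comp (primrec_wordStep.comp Primrec.fst (Primrec.snd.comp Primrec.snd))
          (Primrec.const []))
    refine (Primrec.nat_rec (Primrec.const []) h1).of_eq fun p n => ?_
    induction n with
    | zero => rfl
    | succ n ih => rw [wordList, ← ih]
  exact primrec_wordStep.comp Primrec.fst h

/-- Free reduction is a right fold: each letter cancels against the head of the reduced tail or is
put in front of it. -/
theorem primrec_reduce : Primrec (FreeGroup.reduce : NatWord → NatWord) := by
  have hx : Primrec fun y : (NatWord × (ℕ × Bool) × NatWord) × (ℕ × Bool) × NatWord => y.1.2.1 :=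
    Primrec.fst.comp (Primrec.snd.comp Primrec.fst)
  have hy : Primrec fun y : (NatWord × (ℕ × Bool) × NatWord) × (ℕ × Bool) × NatWord => y.2.1 :=
    Primrec.fst.comp Primrec.snd
  have ht : Primrec fun y : (NatWord × (ℕ × Bool) × NatWord) × (ℕ × Bool) × NatWord => y.2.2 :=
    Primrec.snd.comp Primrec.snd
  have hc : Primrec₂ fun (a : NatWord × (ℕ × Bool) × NatWord) (b : (ℕ × Bool) × NatWord) =>
      if a.2.1.1 = b.1.1 ∧ a.2.1.2 = !b.1.2 then b.2 else a.2.1 :: b.1 :: b.2 :=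
    Primrec.ite ((Primrec.eq.comp (Primrec.fst.comp hx) (Primrec.fst.comp hy)).and
      (Primrec.eq.comp (Primrec.snd.comp hx) (Primrec.not.comp (Primrec.snd.comp hy)))) ht
      (Primrec.list_cons.comp hx (Primrec.list_cons.comp hy ht))
  have hstep : Primrec₂ fun (_ : NatWord) (b : (ℕ × Bool) × NatWord) =>
      (List.casesOn b.2 [b.1] fun y t =>
        if b.1.1 = y.1 ∧ b.1.2 = !y.2 then t else b.1 :: y :: t : NatWord) :=
    Primrec.list_casesOn (Primrec.snd.comp Primrec.snd)
      (Primrec.list_cons.comp (Primrec.fst.comp Primrec.snd) (Primrec.const [])) hc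
  refine (Primrec.list_foldr Primrec.id (Primrec.const []) hstep).of_eq fun l => ?_
  induction l with
  | nil => rfl
  | cons x l ih =>
    rw [FreeGroup.reduce.cons, ← ih]
    rfl

/-- The test that decides the word problem. -/
def sameWords (c : ℕ × ℕ) : Prop :=
  -- The values `q` are the primes up to the sum of the codes, by trial division, and `0` for all
  -- larger primes.
  ∀ q < c.1 + c.2 + 1, (q = 0 ∨ 2 ≤ q ∧ ∀ d < q, d < 2 ∨ q % d ≠ 0) →
    FreeGroup.reduce (codeWord q c.1) = FreeGroup.reduce (codeWord q c.2)

theorem primrecPred_sameWords : PrimrecPred sameWords := by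
  have hd : PrimrecRel fun d q : ℕ => d < 2 ∨ q % d ≠ 0 :=
    PrimrecPred.or (Primrec.nat_lt.comp Primrec.fst (Primrec.const 2))
      (PrimrecPred.not (Primrec.eq.comp (Primrec.nat_mod.comp Primrec.snd Primrec.fst)
        (Primrec.const 0)))
  have hp : PrimrecPred fun q : ℕ => q = 0 ∨ 2 ≤ q ∧ ∀ d < q, d < 2 ∨ q % d ≠ 0 :=
    PrimrecPred.or (Primrec.eq.comp Primrec.id (Primrec.const 0))
      (PrimrecPred.and (Primrec.nat_le.comp (Primrec.const 2) Primrec.id)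
        (hd.forall_lt.comp Primrec.id Primrec.id))
  have he : PrimrecRel fun (q : ℕ) (c : ℕ × ℕ) =>
      ¬ (q = 0 ∨ 2 ≤ q ∧ ∀ d < q, d < 2 ∨ q % d ≠ 0) ∨
        FreeGroup.reduce (codeWord q c.1) = FreeGroup.reduce (codeWord q c.2) :=
    PrimrecPred.or (PrimrecPred.not (hp.comp Primrec.fst))
      (Primrec.eq.comp
        (primrec_reduce.comp (primrec_codeWord.comp Primrec.fst (Primrec.fst.comp Primrec.snd)))
        (primrec_reduce.comp (primrec_codeWord.comp Primrec.fst (Primrec.snd.comp Primrec.snd))))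
  refine (he.forall_mem_list.comp (Primrec.list_range.comp (Primrec.succ.comp
    (Primrec.nat_add.comp Primrec.fst Primrec.snd))) Primrec.id).of_eq fun c => ?_
  simp only [← imp_iff_not_or, List.mem_range]
  rfl

theorem sameWords_iff {A : Type*} [Encodable A] (s t : SigmaTerm A) :
    sameWords (s.code, t.code) ↔
      ∀ p : ℕ, p.Prime → s.toFreeGroup p = t.toFreeGroup p := by
  have key : ∀ q, FreeGroup.reduce (codeWord q s.code) = FreeGroup.reduce (codeWord q t.code) ↔
      s.toFreeGroup q = t.toFreeGroup q := by
    intro q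
    rw [← (FreeGroup.map_injective Encodable.encode_injective).eq_iff, ← mk_codeWord, ← mk_codeWord]
    exact ⟨FreeGroup.reduce.exact, FreeGroup.reduce.sound⟩
  have prime : ∀ q : ℕ, (2 ≤ q ∧ ∀ d < q, d < 2 ∨ q % d ≠ 0) ↔ q.Prime := by
    intro q
    rw [Nat.prime_def_lt']
    refine and_congr_right fun _ => ⟨fun h d hd hdq hdvd => ?_, fun h d hdq => ?_⟩
    · rcases h d hdq with h | h
      · omega
      · exact h (Nat.mod_eq_zero_of_dvd hdvd)
    · by_cases hd : d < 2
      · exact Or.inl hd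
      · exact Or.inr fun h0 => h d (by omega) hdq (Nat.dvd_of_mod_eq_zero h0)
  simp only [sameWords, key, prime]
  constructor
  · intro h p hp
    by_cases hlt : p < s.code + t.code + 1
    · exact h p hlt (Or.inr hp)
    · rw [SigmaTerm.toFreeGroup_eq_of_code_lt s (by omega),
        SigmaTerm.toFreeGroup_eq_of_code_lt t (by omega)]
      exact h 0 (by omega) (Or.inl rfl)
  · rintro h q - (rfl | hq)
    -- The case `q = 0` is realized by an actual prime beyond both codes.
    · obtain ⟨p, hle, hp⟩ := Nat.exists_infinite_primes (s.code + t.code + 1)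
      rw [← SigmaTerm.toFreeGroup_eq_of_code_lt s (p := p) (by omega),
        ← SigmaTerm.toFreeGroup_eq_of_code_lt t (p := p) (by omega)]
      exact h p hp
    · exact h q hq

/-! ### Decidability of the word problem -/

theorem mem_Gnil {G : Type} [Group G] [Finite G] [Group.IsNilpotent G] :
    (⟨G⟩ : FinSemigroup) ∈ Gnil := ⟨G, ‹_›, ‹_›, ⟨MulEquiv.refl G⟩⟩

/-- Finite nilpotent groups are residually `p`-groups, for varying primes `p`. -/
theorem exists_prime_isPGroup_hom {G : Type} [Group G] [Finite G] [Group.IsNilpotent G]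
    {g h : G} (hgh : g ≠ h) :
    ∃ p : ℕ, p.Prime ∧ ∃ (P : Type) (_ : Group P) (_ : Finite P) (f : G →* P),
      IsPGroup p P ∧ f g ≠ f h := by
  -- The group is the product of its Sylow subgroups; distinct elements differ in some coordinate.
  obtain ⟨e⟩ := ((Group.isNilpotent_of_finite_tfae (G := G)).out 0 4 rfl rfl).mp ‹_›
  have hne : e.symm g ≠ e.symm h := fun he => hgh (e.symm.injective he)
  obtain ⟨p, hp⟩ := Function.ne_iff.mp hne
  obtain ⟨P, hP⟩ := Function.ne_iff.mp hp
  exact ⟨p, Nat.prime_of_mem_primeFactors p.2, P, inferInstance, inferInstance,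
    ((Pi.evalMonoidHom _ P).comp (Pi.evalMonoidHom _ p)).comp e.symm.toMonoidHom,
    P.isPGroup', hP⟩

/-- Implicit operations on finite nilpotent groups are determined by their values on finite
`p`-groups. -/
theorem implicitOp_Gnil_ext {A : Type*} {u v : ImplicitOp Gnil A}
    (h : ∀ p : ℕ, p.Prime → ∀ (G : Type) [Group G] [Finite G], IsPGroup p G →
      ∀ (hG : (⟨G⟩ : FinSemigroup) ∈ Gnil) (φ : A → G), u.op ⟨G⟩ hG φ = v.op ⟨G⟩ hG φ) :
    u = v := by
  ext S hS φ
  by_contra hne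
  obtain ⟨G, _, _, ⟨e⟩⟩ := id hS
  have : Finite G := Finite.of_equiv S e.toEquiv
  have hne' : e (u.op S hS φ) ≠ e (v.op S hS φ) := fun he => hne (e.injective he)
  obtain ⟨p, hp, P, _, _, f, hP, hf⟩ := exists_prime_isPGroup_hom hne'
  have : Fact p.Prime := ⟨hp⟩
  have := hP.isNilpotent
  have hPV : (⟨P⟩ : FinSemigroup) ∈ Gnil := mem_Gnil
  let F : S →ₙ* (⟨P⟩ : FinSemigroup) :=
    { toFun := fun s => f (e s)
      map_mul' := fun a b => (congrArg f (map_mul e a b)).trans (map_mul f _ _) }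
  refine hf ?_
  have hu : f (e (u.op S hS φ)) = u.op ⟨P⟩ hPV (F ∘ φ) := u.natural S ⟨P⟩ hS hPV F φ
  have hv : f (e (v.op S hS φ)) = v.op ⟨P⟩ hPV (F ∘ φ) := v.natural S ⟨P⟩ hS hPV F φ
  rw [hu, hv]
  exact h p hp P hP hPV _

/-- Residual finiteness of the free group in `p`-groups, for each `p` separately, gives the forward
direction; the backward one needs only that `p`-groups separate implicit operations on nilpotent
groups. -/
theorem value_eq_iff {A : Type*} (s t : SigmaTerm A) :
    s.value Gnil = t.value Gnil ↔ ∀ p : ℕ, p.Prime → s.toFreeGroup p = t.toFreeGroup p := by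
  constructor
  · intro h p hp
    by_contra hne
    have : Fact p.Prime := ⟨hp⟩
    obtain ⟨G, _, _, f, hG, hf⟩ := exists_isPGroup_hom_ne_one p (mt div_eq_one.mp hne)
    have := hG.isNilpotent
    refine hf ?_
    rw [map_div, div_eq_one]
    have hst : s.eval Gnil = t.eval Gnil := congrArg Subtype.val h
    have hf' : FreeGroup.lift (fun a => f (FreeGroup.of a)) = f := by
      ext a
      simp
    rw [← hf', ← SigmaTerm.eval_eq_lift hG mem_Gnil, ← SigmaTerm.eval_eq_lift hG mem_Gnil, hst]
  · intro h
    refine Subtype.ext (implicitOp_Gnil_ext fun p hp G _ _ hG hGV φ => ?_)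
    have : Fact p.Prime := ⟨hp⟩
    change (s.eval Gnil).op ⟨G⟩ hGV φ = (t.eval Gnil).op ⟨G⟩ hGV φ
    rw [SigmaTerm.eval_eq_lift hG, SigmaTerm.eval_eq_lift hG, h p hp]

end SigmaWord

theorem mainTheorem6 (A : Type*) [Finite A] [Encodable A] :
    SigmaWord.DecidableWordProblem SigmaWord.Gnil A := by
  classical
  refine ⟨fun c => decide (SigmaWord.sameWords c),
    SigmaWord.primrecPred_sameWords.decide.to_comp, fun s t => ?_⟩
  rw [decide_eq_true_iff, SigmaWord.sameWords_iff, SigmaWord.value_eq_iff]
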